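/- Let $q\ge 1$ and $m\ge 0$ be integers, let $\alpha\in\mathbb{R}$, and let $s_0,\dots,s_m$ be complex $q\times q$ matrices. Write $A^\dagger$ for the Moore–Penrose inverse of a complex matrix $A$. **Hankel matrices.** For a finite sequence $t=(t_j)_{j=0}^{\ell}$ of complex $q\times q$ matrices, put $H_n(t)=(t_{j+k})_{j,k=0}^n$ if $2n\le \ell$ and $K_n(t)=(t_{j+k+1})_{j,k=0}^n$ if $2n+1\le \ell$; write $H_n=H_n(s)$ and $K_n=K_n(s)$. Assume that $(s_j)_{j=0}^m$ is $\alpha$-Stieltjes non-negative definite, $(s_j)_{j=0}^m\in\mathcal K^{\ge}_{q,m,\alpha}$, i.e.: if $m=0$, then $H_0$ is non-negative Hermitian; if $m=2n$ with $n\ge1$, then $H_n$ and $-\alpha H_{n-1}+K_{n-1}$ are non-negative Hermitian; if $m=2n+1$ with $n\ge0$, then $H_n$ and $-\alpha H_n+K_n$ are non-negative Hermitian. **Right $\alpha$-Stieltjes parametrization.** For $t=(t_j)_{j=0}^{\ell}$ let $L_0(t)=t_0$ and, for $n\ge1$ with $2n\le \ell$, $$L_n(t)=t_{2n}-(t_n,\dots,t_{2n-1})\,H_{n-1}(t)^\dagger\begin{pmatrix}t_n\\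 \vdots\\ t_{2n-1}\end{pmatrix}.$$ With $s_{\alpha,j}=-\alpha s_j+s_{j+1}$ for $0\le j\le m-1$, let $Q_{2k}=L_k\big((s_j)_{j=0}^m\big)$ for $0\le 2k\le m$ and $Q_{2k+1}=L_k\big((s_{\alpha,j})_{j=0}^{m-1}\big)$ for $1\le 2k+1\le m$. **$\alpha$-Schur transforms.** For $t=(t_j)_{j=0}^{\ell}$ with $\ell\ge1$ let $u_0=t_0$ and $u_j=-\alpha t_{j-1}+t_j$ for $1\le j\le \ell$; let $r_0=u_0^\dagger$ and $r_j=-u_0^\dagger\sum_{l=0}^{j-1}u_{j-l}r_l$ for $1\le j\le \ell$. The first $\alpha$-Schur transform of $t$ is the sequence $(-t_0r_{j+1}t_0)_{j=0}^{\ell-1}$. Let $s_j^{[0,\alpha]}=s_j$ for $0\le j\le m$ and, for $1\le k\le m$, let $(s_j^{[k,\alpha]})_{j=0}^{m-k}$ be the first $\alpha$-Schur transform of $(s_j^{[k-1,\alpha]})_{j=0}^{m-k+1}$. **Correction term.** For $0\le k\le m$ and $0\le j\le m-k$ let $$P_{j,k}=s_j^{[k,\alpha]}-s_0^{[k,\alpha]}\big(s_0^{[k,\alpha]}\big)^\dagger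 s_j^{[k,\alpha]}\big(s_0^{[k,\alpha]}\big)^\dagger s_0^{[k,\alpha]},$$ and let $Z_{m,m}=\sum_{k=0}^{m-1}P_{m-k,k}$ (so $Z_{0,0}=0$). Then $$Q_m=s_0^{[m,\alpha]}+Z_{m,m}\qquad\text{and}\qquad Q_j=s_0^{[j,\alpha]}\quad\text{for all integers } 0\le j\le m-1 .$$ -/

import Mathlib

namespace AlphaStieltjes

noncomputable section

open Matrix
open scoped ComplexOrder

/-! ### The Moore-Penrose inverse of a complex matrix -/

/-- `X` satisfies the four Penrose equations for `A`. -/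
def IsMoorePenrose {m n : Type*} [Fintype m] [Fintype n]
    (A : Matrix m n ℂ) (X : Matrix n m ℂ) : Prop :=
  A * X * A = A ∧ X * A * X = X ∧ (A * X)ᴴ = A * X ∧ (X * A)ᴴ = X * A

theorem IsMoorePenrose.unique {m n : Type*} [Fintype m] [Fintype n]
    {A : Matrix m n ℂ} {X Y : Matrix n m ℂ}
    (hX : IsMoorePenrose A X) (hY : IsMoorePenrose A Y) : X = Y := by
  obtain ⟨x1, x2, x3, x4⟩ := hX
  obtain ⟨y1, y2, y3, y4⟩ := hY
  have h1 : A * X = A * Y := by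
    calc A * X = (A * X)ᴴ := x3.symm
      _ = ((A * Y) * (A * X))ᴴ := by rw [← Matrix.mul_assoc (A * Y), y1]
      _ = (A * X) * (A * Y) := by rw [conjTranspose_mul, x3, y3]
      _ = A * Y := by rw [← Matrix.mul_assoc (A * X), x1]
  have h2 : X * A = Y * A := by
    calc X * A = (X * A)ᴴ := x4.symm
      _ = ((X * A) * (Y * A))ᴴ := by
          rw [Matrix.mul_assoc X A (Y * A), ← Matrix.mul_assoc A Y A, y1]
      _ = (Y * A) * (X * A) := by rw [conjTranspose_mul, x4, y4]
      _ = Y * A := by rw [Matrix.mul_assoc Y A (X * A), ← Matrix.mul_assoc A X A, x1]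
  calc X = X * A * X := x2.symm
    _ = Y * (A * X) := by rw [h2, Matrix.mul_assoc]
    _ = Y * A * Y := by rw [h1, Matrix.mul_assoc]
    _ = Y := y2

theorem exists_isMoorePenrose_of_isHermitian {n : Type*} [Fintype n]
    {B : Matrix n n ℂ} (hB : B.IsHermitian) : ∃ X, IsMoorePenrose B X := by
  classical
  set U : Matrix n n ℂ := (hB.eigenvectorUnitary : Matrix n n ℂ) with hU
  have hUU : Uᴴ * U = 1 := Unitary.coe_star_mul_self hB.eigenvectorUnitary
  set d : n → ℂ := fun i => (hB.eigenvalues i : ℂ) with hd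
  have hBd : B = U * diagonal d * Uᴴ := by
    have := hB.spectral_theorem
    rw [Unitary.conjStarAlgAut_apply] at this
    exact this
  have key : ∀ e f : n → ℂ, (U * diagonal e * Uᴴ) * (U * diagonal f * Uᴴ)
      = U * diagonal (fun i => e i * f i) * Uᴴ := by
    intro e f
    rw [← diagonal_mul_diagonal]
    calc (U * diagonal e * Uᴴ) * (U * diagonal f * Uᴴ)
        = U * diagonal e * (Uᴴ * U) * diagonal f * Uᴴ := by simp only [Matrix.mul_assoc]
      _ = U * (diagonal e * diagonal f) * Uᴴ := by rw [hUU]; simp only [Matrix.mul_assoc, Matrix.one_mul]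
  have keyH : ∀ e : n → ℂ, (U * diagonal e * Uᴴ)ᴴ
      = U * diagonal (fun i => star (e i)) * Uᴴ := by
    intro e
    rw [conjTranspose_mul, conjTranspose_mul, conjTranspose_conjTranspose,
      diagonal_conjTranspose, Matrix.mul_assoc]
    rfl
  refine ⟨U * diagonal (fun i => (d i)⁻¹) * Uᴴ, ?_, ?_, ?_, ?_⟩
  · rw [hBd, key, key]
    congr 3
    funext i
    exact mul_inv_mul_cancel (d i)
  · rw [hBd, key, key]
    congr 3
    funext i
    simpa using mul_inv_mul_cancel (d i)⁻¹
  · rw [hBd, key, keyH]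
    congr 3
    funext i
    simp [hd]
  · rw [hBd, key, keyH]
    congr 3
    funext i
    simp [hd]

theorem exists_isMoorePenrose {m n : Type*} [Fintype m] [Fintype n]
    (A : Matrix m n ℂ) : ∃ X, IsMoorePenrose A X := by
  classical
  obtain ⟨G, g1, g2, g3, g4⟩ :=
    exists_isMoorePenrose_of_isHermitian (isHermitian_conjTranspose_mul_self A)
  have hGH : Gᴴ = G := by
    refine IsMoorePenrose.unique (A := Aᴴ * A) ⟨?_, ?_, ?_, ?_⟩ ⟨g1, g2, g3, g4⟩
    · have := congrArg conjTranspose g1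
      simpa [conjTranspose_mul, Matrix.mul_assoc] using this
    · have := congrArg conjTranspose g2
      simpa [conjTranspose_mul, Matrix.mul_assoc] using this
    · have e : Aᴴ * A * Gᴴ = G * (Aᴴ * A) := by
        rw [← g4]; simp [conjTranspose_mul, Matrix.mul_assoc]
      rw [e, g4]
    · have e : Gᴴ * (Aᴴ * A) = Aᴴ * A * G := by
        rw [← g3]; simp [conjTranspose_mul, Matrix.mul_assoc]
      rw [e, g3]
  have hA : A * G * (Aᴴ * A) = A := by
    rw [← sub_eq_zero, ← conjTranspose_mul_self_eq_zero]
    have h0 : Aᴴ * (A * G * (Aᴴ * A) - A) = 0 := by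
      rw [Matrix.mul_sub, sub_eq_zero]
      calc Aᴴ * (A * G * (Aᴴ * A)) = Aᴴ * A * G * (Aᴴ * A) := by simp only [Matrix.mul_assoc]
        _ = Aᴴ * A := g1
    have h1 : (A * G * (Aᴴ * A) - A) = A * (G * (Aᴴ * A) - 1) := by
      rw [Matrix.mul_sub, Matrix.mul_one, Matrix.mul_assoc]
    calc (A * G * (Aᴴ * A) - A)ᴴ * (A * G * (Aᴴ * A) - A)
        = (G * (Aᴴ * A) - 1)ᴴ * (Aᴴ * (A * G * (Aᴴ * A) - A)) := by
          conv_rhs => rw [← Matrix.mul_assoc (G * (Aᴴ * A) - 1)ᴴ, ← conjTranspose_mul, ← h1]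
      _ = 0 := by rw [h0, Matrix.mul_zero]
  refine ⟨G * Aᴴ, ?_, ?_, ?_, ?_⟩
  · simpa [Matrix.mul_assoc] using hA
  · have : G * (Aᴴ * A) * G * Aᴴ = G * Aᴴ := by rw [g2]
    simpa [Matrix.mul_assoc] using this
  · simp [conjTranspose_mul, hGH, Matrix.mul_assoc]
  · rw [Matrix.mul_assoc, g4]

/-- The Moore-Penrose inverse of a complex matrix. -/
def mpInv {m n : Type*} [Fintype m] [Fintype n] (A : Matrix m n ℂ) : Matrix n m ℂ :=
  Classical.choose (exists_isMoorePenrose A)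

theorem mpInv_spec {m n : Type*} [Fintype m] [Fintype n] (A : Matrix m n ℂ) :
    IsMoorePenrose A (mpInv A) :=
  Classical.choose_spec (exists_isMoorePenrose A)

/-!
### Block Hankel matrices

A finite sequence `s_0, ..., s_m` of complex `p × q` matrices is given by a function
`s : ℕ → Matrix (Fin p) (Fin q) ℂ` of which only the values at `0, ..., m` are used.
A block matrix with `N × M` blocks of size `p × q` has the index types `Fin N × Fin p` and
`Fin M × Fin q`.
-/

/-- The block Hankel matrix `H_n = (s_{j+k})_{j,k=0}^n`. -/
def H {p q : ℕ} (s : ℕ → Matrix (Fin p) (Fin q) ℂ) (n : ℕ) :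
    Matrix (Fin (n + 1) × Fin p) (Fin (n + 1) × Fin q) ℂ :=
  Matrix.of fun a b => s ((a.1 : ℕ) + (b.1 : ℕ)) a.2 b.2

/-- The block Hankel matrix `K_n = (s_{j+k+1})_{j,k=0}^n`. -/
def K {p q : ℕ} (s : ℕ → Matrix (Fin p) (Fin q) ℂ) (n : ℕ) :
    Matrix (Fin (n + 1) × Fin p) (Fin (n + 1) × Fin q) ℂ :=
  Matrix.of fun a b => s ((a.1 : ℕ) + (b.1 : ℕ) + 1) a.2 b.2

/-- The block column with the `N` blocks `s_l, s_{l+1}, ..., s_{l+N-1}`. -/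
def yCol {p q : ℕ} (s : ℕ → Matrix (Fin p) (Fin q) ℂ) (l N : ℕ) :
    Matrix (Fin N × Fin p) (Fin q) ℂ :=
  Matrix.of fun a b => s (l + (a.1 : ℕ)) a.2 b

/-- The block row with the `N` blocks `s_l, s_{l+1}, ..., s_{l+N-1}`. -/
def zRow {p q : ℕ} (s : ℕ → Matrix (Fin p) (Fin q) ℂ) (l N : ℕ) :
    Matrix (Fin p) (Fin N × Fin q) ℂ :=
  Matrix.of fun a b => s (l + (b.1 : ℕ)) a b.2

/-- The sequence `-α s_j + s_{j+1}`. -/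
def shift {p q : ℕ} (α : ℂ) (s : ℕ → Matrix (Fin p) (Fin q) ℂ) :
    ℕ → Matrix (Fin p) (Fin q) ℂ :=
  fun j => -α • s j + s (j + 1)

/-- The sequence `s_0, ..., s_m` is `α`-Stieltjes non-negative definite: for `m = 0` the matrix
`H_0` is non-negative Hermitian, for `m = 2n` with `n ≥ 1` the matrices `H_n` and
`-α H_{n-1} + K_{n-1}` are non-negative Hermitian, for `m = 2n + 1` the matrices `H_n` and
`-α H_n + K_n` are non-negative Hermitian. -/
def IsStieltjesNonneg {q : ℕ} (α : ℝ) (m : ℕ) (s : ℕ → Matrix (Fin q) (Fin q) ℂ) : Prop :=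
  (H s (m / 2)).PosSemidef ∧
    (1 ≤ m → (-(α : ℂ) • H s ((m - 1) / 2) + K s ((m - 1) / 2)).PosSemidef)

/-! ### The right `α`-Stieltjes parametrization -/

/-- `L_0 = s_0` and `L_n = s_{2n} - (s_n, ..., s_{2n-1}) H_{n-1}^† col(s_n, ..., s_{2n-1})`. -/
def L {p q : ℕ} (s : ℕ → Matrix (Fin p) (Fin q) ℂ) : ℕ → Matrix (Fin p) (Fin q) ℂ
  | 0 => s 0
  | n + 1 => s (2 * (n + 1)) - zRow s (n + 1) (n + 1) * mpInv (H s n) * yCol s (n + 1) (n + 1)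

/-- The right `α`-Stieltjes parametrization: `Q_{2k} = L_k` built from the sequence itself and
`Q_{2k+1} = L_k` built from the sequence `-α s_j + s_{j+1}`. -/
def Q {p q : ℕ} (α : ℂ) (s : ℕ → Matrix (Fin p) (Fin q) ℂ) (j : ℕ) :
    Matrix (Fin p) (Fin q) ℂ :=
  if Even j then L s (j / 2) else L (shift α s) (j / 2)

/-! ### The `α`-Schur transforms -/

/-- The reciprocal sequence: `s_0^♯ = s_0^†` and `s_j^♯ = -s_0^† ∑_{l=0}^{j-1} s_{j-l} s_l^♯`. -/
def reciprocal {p q : ℕ} (s : ℕ → Matrix (Fin p) (Fin q) ℂ) : ℕ → Matrix (Fin q) (Fin p) ℂ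
  | 0 => mpInv (s 0)
  | j + 1 => -(mpInv (s 0) * ∑ l : Fin (j + 1), s (j + 1 - (l : ℕ)) * reciprocal s (l : ℕ))
decreasing_by exact l.isLt

/-- The sequence `-α s_{j-1} + s_j`, where `s_{-1} = 0`. -/
def plusTransform {p q : ℕ} (α : ℂ) (s : ℕ → Matrix (Fin p) (Fin q) ℂ) :
    ℕ → Matrix (Fin p) (Fin q) ℂ
  | 0 => s 0
  | j + 1 => -α • s j + s (j + 1)

/-- The first `α`-Schur transform `s_0 (-r_{j+1}) s_0`, where `r` is the reciprocal sequence of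
the sequence `-α s_{j-1} + s_j`. -/
def schurStep {p q : ℕ} (α : ℂ) (s : ℕ → Matrix (Fin p) (Fin q) ℂ) :
    ℕ → Matrix (Fin p) (Fin q) ℂ :=
  fun j => s 0 * (-reciprocal (plusTransform α s) (j + 1)) * s 0

/-- The `k`-th `α`-Schur transform; `schur α s k j` is `s_j^{[k,α]}`. -/
def schur {p q : ℕ} (α : ℂ) (s : ℕ → Matrix (Fin p) (Fin q) ℂ) :
    ℕ → ℕ → Matrix (Fin p) (Fin q) ℂ
  | 0 => s
  | k + 1 => schurStep α (schur α s k)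

/-- The defect matrix `P_{j,k} = s_j^{[k,α]} - s_0^{[k,α]} (s_0^{[k,α]})^† s_j^{[k,α]}
(s_0^{[k,α]})^† s_0^{[k,α]}`. -/
def P {p q : ℕ} (α : ℂ) (s : ℕ → Matrix (Fin p) (Fin q) ℂ) (j k : ℕ) :
    Matrix (Fin p) (Fin q) ℂ :=
  schur α s k j -
    schur α s k 0 * mpInv (schur α s k 0) * schur α s k j * mpInv (schur α s k 0) * schur α s k 0

/-- `Z_{l,m} = ∑_{k=0}^{m-1} P_{l-k,k}` for `m ≤ l`; in particular `Z_{l,0} = 0`. -/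
def Z {p q : ℕ} (α : ℂ) (s : ℕ → Matrix (Fin p) (Fin q) ℂ) (l m : ℕ) :
    Matrix (Fin p) (Fin q) ℂ :=
  ∑ k ∈ Finset.range m, P α s (l - k) k

end

end AlphaStieltjes

/-! The proof is an induction on `m`. One Schur step shortens the sequence by one, preserves the
`α`-Stieltjes property and shifts the parameters: the `j`-th parameter of the transform is the
`(j+1)`-st of `s`, except that the last one differs by the defect `P (m + 1) 0`
(`IsStieltjesNonneg.schurStep`).

Suppose first that all `s_j` are Hermitian with range in that of `a = s_0`. Put `b = a^†`, let `e =
ab` be the range projection, `F` the generating series and `G` the reciprocal one, so that `FG = GF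
= e`. Vanishing of the higher coefficients of `FG` says that Toeplitz and Hankel matrices of `F` and
`G` intertwine. Hence the Hankel matrix of `-a G_{k+1} a` is a congruence, by a lower unitriangular
Toeplitz matrix, of that of `F_{k+1}`; for `-a G_{k+2} a` one gets the Schur complement of `s_0` in
the Hankel matrix of `F`. The first, applied to `(1 - αz)F`, relates the transform to the shifted
sequence; the second, applied to `F`, relates the shifted transform to `s`. Such congruences, and
elimination of the first entry, preserve non-negativity and the last Schur complement, and that
complement is `L_n`.

In general positivity gives the range condition for every index but the last. Compressing `s_m` by
`e` on both sides leaves the transform unchanged, since `s_m` enters it only through `b s_m b`, and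
changes `Q_m` by exactly `s_m - e s_m e`, the defect. -/

namespace AlphaStieltjes

noncomputable section

open Matrix
open scoped ComplexOrder

/-! ### Toeplitz and Hankel matrices of formal power series -/

section Ring

variable {R : Type*} [Ring R]

/-- The lower triangular Toeplitz matrix of a power series. -/
def toep (n : ℕ) (F : PowerSeries R) : Matrix (Fin n) (Fin n) R :=
  Matrix.of fun i j => if j ≤ i then PowerSeries.coeff ((i : ℕ) - j) F else 0

/-- The Hankel matrix of a sequence. -/
def hank (n : ℕ) (f : ℕ → R) : Matrix (Fin n) (Fin n) R :=
  Matrix.of fun i j => f ((i : ℕ) + j)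

theorem sum_fin_ite_le {n : ℕ} (i : Fin n) (φ : ℕ → R) :
    ∑ k : Fin n, (if k ≤ i then φ k else 0) = ∑ k ∈ Finset.range (i + 1), φ k := by
  have h := Fin.sum_univ_eq_sum_range (fun k => if k ≤ (i : ℕ) then φ k else 0) n
  simp only [Fin.val_fin_le] at h
  rw [h, ← Finset.sum_filter]
  congr 1
  ext k
  simp only [Finset.mem_filter, Finset.mem_range]
  omega

theorem toep_mul_apply {n : ℕ} (F : PowerSeries R) (M : Matrix (Fin n) (Fin n) R)
    (φ : ℕ → R) (i j : Fin n) (h : ∀ k : Fin n, M k j = φ k) :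
    (toep n F * M) i j = ∑ k ∈ Finset.range (i + 1), PowerSeries.coeff (i - k) F * φ k := by
  rw [← sum_fin_ite_le i (fun k => PowerSeries.coeff (i - k) F * φ k), Matrix.mul_apply]
  refine Finset.sum_congr rfl fun k _ => ?_
  by_cases hk : k ≤ i <;> simp [toep, hk, h]

theorem mul_toep_transpose_apply {n : ℕ} (F : PowerSeries R) (M : Matrix (Fin n) (Fin n) R)
    (φ : ℕ → R) (i j : Fin n) (h : ∀ k : Fin n, M i k = φ k) :
    (M * (toep n F)ᵀ) i j = ∑ k ∈ Finset.range (j + 1), φ k * PowerSeries.coeff (j - k) F := by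
  rw [← sum_fin_ite_le j (fun k => φ k * PowerSeries.coeff (j - k) F), Matrix.mul_apply]
  refine Finset.sum_congr rfl fun k _ => ?_
  by_cases hk : k ≤ j <;> simp [toep, hk, h]

theorem toep_mul {n : ℕ} (F G : PowerSeries R) : toep n (F * G) = toep n F * toep n G := by
  ext i j
  rw [toep_mul_apply F (toep n G)
    (fun k => if (j : ℕ) ≤ k then PowerSeries.coeff (k - j) G else 0) i j
    (fun k => rfl)]
  by_cases h : j ≤ i
  · have h' : (j : ℕ) ≤ i := h
    obtain ⟨d, hd⟩ := Nat.exists_eq_add_of_le h'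
    have h1 : (i : ℕ) + 1 = j + (d + 1) := by omega
    rw [h1, Finset.sum_range_add, Finset.sum_eq_zero, zero_add]
    · simp only [toep, Matrix.of_apply, if_pos h, hd, Nat.add_sub_cancel_left, PowerSeries.coeff_mul]
      rw [← Finset.Nat.sum_antidiagonal_swap, Finset.Nat.sum_antidiagonal_eq_sum_range_succ_mk]
      refine Finset.sum_congr rfl fun k _ => ?_
      simp [Nat.add_sub_add_left]
    · intro k hk
      have : ¬ (j : ℕ) ≤ k := by simpa using hk
      simp [this]
  · have h' : ¬ (j : ℕ) ≤ i := h
    rw [Finset.sum_eq_zero]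
    · simp [toep, h]
    · intro k hk
      have : ¬ (j : ℕ) ≤ k := by have := Finset.mem_range.1 hk; omega
      simp [this]

theorem toep_add {n : ℕ} (F G : PowerSeries R) : toep n (F + G) = toep n F + toep n G := by
  ext i j
  by_cases h : j ≤ i <;> simp [toep, h]

theorem toep_C {n : ℕ} (x : R) : toep n (PowerSeries.C x) = Matrix.diagonal fun _ => x := by
  ext i j
  by_cases h : i = j
  · simp [toep, h]
  · have h0 : (i : ℕ) ≠ j := fun h' => h (Fin.ext h')
    by_cases h1 : j ≤ i
    · have h2 : (i : ℕ) - j ≠ 0 := by have : (j : ℕ) ≤ i := h1; omega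
      simp [toep, h, h1, PowerSeries.coeff_C, h2]
    · simp [toep, h, h1]

theorem toep_mulVec_single {n : ℕ} (F : PowerSeries R) (x : R) :
    toep (n + 1) F *ᵥ Pi.single (Fin.last n) x
      = Pi.single (Fin.last n) (PowerSeries.constantCoeff F * x) := by
  ext i
  rw [Matrix.mulVec_single]
  by_cases h : i = Fin.last n
  · subst h; simp [toep]
  · have : ¬ Fin.last n ≤ i := fun h' => h (Fin.last_le_iff.1 h')
    simp [toep, h, this]

/-- The convolution is cut according to whether the index on `F` is at most `i`. The two pieces are
the `(i, j)` entries of Toeplitz times Hankel and of Hankel times transposed Toeplitz. -/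
theorem coeff_mul_split (F G : PowerSeries R) (i j : ℕ) :
    PowerSeries.coeff (i + j + 1) (F * G) =
      ∑ k ∈ Finset.range (i + 1), PowerSeries.coeff (i - k) F * PowerSeries.coeff (k + j + 1) G +
      ∑ k ∈ Finset.range (j + 1),
        PowerSeries.coeff (i + k + 1) F * PowerSeries.coeff (j - k) G := by
  rw [PowerSeries.coeff_mul, ← Finset.Nat.sum_antidiagonal_swap,
    Finset.Nat.sum_antidiagonal_eq_sum_range_succ_mk]
  have h1 : (i + j + 1).succ = (j + 1) + (i + 1) := by omega
  rw [h1, Finset.sum_range_add, add_comm]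
  congr 1
  · refine Finset.sum_congr rfl fun k _ => ?_
    simp only [Prod.fst_swap, Prod.snd_swap]
    rw [show i + j + 1 - (j + 1 + k) = i - k by omega, show j + 1 + k = k + j + 1 by omega]
  · rw [← Finset.sum_range_reflect]
    refine Finset.sum_congr rfl fun k hk => ?_
    have := Finset.mem_range.1 hk
    simp only [Prod.fst_swap, Prod.snd_swap]
    congr 3
    omega

/-- The Hankel matrix of the Schur complement of the first entry. -/
def hankCompl (n : ℕ) (b : R) (f : ℕ → R) : Matrix (Fin n) (Fin n) R :=
  Matrix.of fun i j => f ((i : ℕ) + j + 2) - f (i + 1) * b * f (j + 1)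

theorem toep_mul_hank_one {n : ℕ} {F G : PowerSeries R} {e : R} (h : F * G = PowerSeries.C e) :
    toep n F * hank n (fun k => PowerSeries.coeff (k + 1) G) =
      -(hank n (fun k => PowerSeries.coeff (k + 1) F) * (toep n G)ᵀ) := by
  rw [eq_neg_iff_add_eq_zero]
  ext i j
  rw [Matrix.add_apply,
    toep_mul_apply F _ (fun k => PowerSeries.coeff (k + j + 1) G) i j (fun k => rfl),
    mul_toep_transpose_apply G _ (fun k => PowerSeries.coeff (i + k + 1) F) i j (fun k => rfl),
    ← coeff_mul_split, h]
  simp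

theorem toep_mul_hank_two {n : ℕ} {F G : PowerSeries R} {b e : R} (h : F * G = PowerSeries.C e)
    (hb : b * PowerSeries.constantCoeff F = e) (hG : PowerSeries.C e * G = G) :
    toep n F * hank n (fun k => PowerSeries.coeff (k + 2) G) =
      -(hankCompl n b (fun k => PowerSeries.coeff k F) * (toep n G)ᵀ) := by
  rw [eq_neg_iff_add_eq_zero]
  ext i j
  rw [Matrix.add_apply,
    toep_mul_apply F _ (fun k => PowerSeries.coeff (k + (j + 1) + 1) G) i j (fun k => rfl),
    mul_toep_transpose_apply G _ (fun k => PowerSeries.coeff (i + k + 2) F -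
      PowerSeries.coeff (i + 1) F * b * PowerSeries.coeff (k + 1) F) i j (fun k => rfl)]
  have h2 := coeff_mul_split F G i (j + 1)
  have h1 := coeff_mul_split F G 0 j
  rw [h, PowerSeries.coeff_C, if_neg (by omega)] at h1 h2
  have hG' : ∀ k, e * PowerSeries.coeff k G = PowerSeries.coeff k G := fun k => by
    conv_rhs => rw [← hG, PowerSeries.coeff_C_mul]
  -- Multiplying the coefficient of degree `j + 1` of `FG = e` by `F_{i+1} b` turns the surplus
  -- boundary term into the correction term of the Schur complement.
  have h3 : PowerSeries.coeff (i + 1) F * PowerSeries.coeff (j + 1) G =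
      -∑ k ∈ Finset.range (j + 1), PowerSeries.coeff (i + 1) F * b * PowerSeries.coeff (k + 1) F *
        PowerSeries.coeff (j - k) G := by
    have h3 := congrArg (fun x => PowerSeries.coeff (i + 1) F * b * x) h1
    simp only [mul_zero, zero_add, Finset.range_one, Finset.sum_singleton, Nat.sub_zero, mul_add,
      PowerSeries.coeff_zero_eq_constantCoeff, Finset.mul_sum] at h3
    rw [← mul_assoc, mul_assoc _ b, hb, mul_assoc, hG'] at h3
    rw [eq_neg_iff_add_eq_zero, h3]
    simp only [mul_assoc]
  rw [Finset.sum_range_succ' _ ((j : ℕ) + 1)] at h2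
  simp only [Nat.add_sub_add_right, add_zero, Nat.sub_zero, h3] at h2
  simp only [sub_mul, Finset.sum_sub_distrib, Matrix.zero_apply]
  rw [h2, ← sub_eq_add_neg]
  rfl

end Ring

/-! ### Schur complements and congruence by unitriangular Toeplitz matrices -/

section StarRing

variable {R : Type*} [Ring R]

/-- `X` is the Schur complement of the leading part of `M` in `M`. -/
def IsSchurCompl {n : ℕ} (M : Matrix (Fin (n + 1)) (Fin (n + 1)) R) (X : R) : Prop :=
  ∃ V : Fin (n + 1) → R, V (Fin.last n) = 1 ∧ M *ᵥ V = Pi.single (Fin.last n) X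

/-- The Schur complement is not changed by the elimination of the first entry. -/
theorem IsSchurCompl.hankCompl {n : ℕ} {b e : R} {f : ℕ → R} {X : R} (hb : b * f 0 = e)
    (he : ∀ k, f k * e = f k) (h : IsSchurCompl (hank (n + 2) f) X) :
    IsSchurCompl (hankCompl (n + 1) b f) X := by
  obtain ⟨V, hV, hVX⟩ := h
  refine ⟨fun i => V i.succ, hV, ?_⟩
  have h0 := congrFun hVX 0
  have hrow : ∀ i : Fin (n + 2), ∑ j : Fin (n + 2), f (i + j) * V j =
      (Pi.single (Fin.last (n + 1)) X : Fin (n + 2) → R) i := fun i => by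
    rw [← hVX]; rfl
  ext i
  have h1 := hrow i.succ
  have h0 := hrow 0
  rw [Pi.single_eq_of_ne (by simp [Fin.ext_iff])] at h0
  rw [Fin.sum_univ_succ] at h0 h1
  have h2 : (Pi.single (Fin.last (n + 1)) X : Fin (n + 2) → R) i.succ =
      (Pi.single (Fin.last n) X : Fin (n + 1) → R) i := by
    rw [← Fin.succ_last]
    simp [Pi.single_apply]
  -- Row `0` of the system, multiplied by `f (i + 1) * b`, expresses `f (i + 1) * V 0` through the
  -- other entries of `V`; this eliminates `V 0` from row `i + 1`.
  have h3 := congrArg (fun x => f (i + 1) * b * x) h0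
  simp only [Fin.val_zero, add_zero, zero_add, mul_zero, mul_add, ← mul_assoc, Fin.val_succ,
    mul_assoc _ b (f 0), hb, he, Finset.mul_sum] at h3
  rw [← h2, ← h1, Fin.val_succ, Fin.val_zero, add_zero, eq_neg_of_add_eq_zero_left h3]
  simp only [Matrix.mulVec, dotProduct, AlphaStieltjes.hankCompl, Matrix.of_apply, sub_mul,
    Finset.sum_sub_distrib, Fin.val_succ]
  rw [sub_eq_neg_add]
  congr 1
  refine Finset.sum_congr rfl fun j _ => ?_
  congr 2
  omega

variable [StarRing R]

/-- Evaluating `V* M W` from both sides gives `X* = Y` for any two Schur complements; applied to `Y`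
twice, it shows `Y* = Y`. -/
theorem IsSchurCompl.unique {n : ℕ} {M : Matrix (Fin (n + 1)) (Fin (n + 1)) R} (hM : Mᴴ = M)
    {X Y : R} (hX : IsSchurCompl M X) (hY : IsSchurCompl M Y) : X = Y := by
  have key : ∀ {X Y : R}, IsSchurCompl M X → IsSchurCompl M Y → star X = Y := by
    rintro X Y ⟨V, hV, hVX⟩ ⟨W, hW, hWY⟩
    have h1 : star V ⬝ᵥ (M *ᵥ W) = Y := by simp [hWY, hV]
    have h2 : star V ⬝ᵥ (M *ᵥ W) = star X := by
      rw [Matrix.dotProduct_mulVec, ← hM, ← Matrix.star_mulVec, hVX, ← Pi.single_star]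
      simp [hW]
    rw [← h1, h2]
  rw [← key hY hX, key hY hY]

theorem IsSchurCompl.toep_conj {n : ℕ} {M : Matrix (Fin (n + 1)) (Fin (n + 1)) R} {X : R}
    {F F' : PowerSeries R} (hF : F' * F = 1) (h0 : PowerSeries.constantCoeff F = 1)
    (h : IsSchurCompl M X) :
    IsSchurCompl (toep (n + 1) F * M * (toep (n + 1) F)ᴴ) X := by
  obtain ⟨V, hV, hVX⟩ := h
  have h0' : PowerSeries.constantCoeff F' = 1 := by
    have := congrArg PowerSeries.constantCoeff hF
    simpa [h0] using this
  -- The adjoint factor is upper unitriangular, so the last entry of the witness is still `1`.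
  refine ⟨(toep (n + 1) F')ᴴ *ᵥ V, ?_, ?_⟩
  · rw [Matrix.mulVec, dotProduct, Finset.sum_eq_single (Fin.last n)]
    · simp [toep, h0', hV]
    · intro k _ hk
      have : ¬ Fin.last n ≤ k := fun h => hk (Fin.last_le_iff.1 h)
      simp [toep, this]
    · simp
  · have h1 : (toep (n + 1) F)ᴴ * (toep (n + 1) F')ᴴ = 1 := by
      rw [← Matrix.conjTranspose_mul, ← toep_mul, hF, ← map_one PowerSeries.C, toep_C,
        Matrix.diagonal_one, Matrix.conjTranspose_one]
    rw [Matrix.mulVec_mulVec, Matrix.mul_assoc, h1, Matrix.mul_one, ← Matrix.mulVec_mulVec, hVX,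
      toep_mulVec_single, h0, one_mul]

/-- A self-adjoint `a` with a commuting pseudo-inverse `b`, and a power series `F` with constant
coefficient `a` and pseudo-inverse `G`. -/
structure IsPseudoInvPair (a b e : R) (F G : PowerSeries R) : Prop where
  ab : a * b = e
  ba : b * a = e
  ea : e * a = a
  star_a : star a = a
  star_e : star e = e
  FG : F * G = PowerSeries.C e
  GF : G * F = PowerSeries.C e
  eG : PowerSeries.C e * G = G
  Ge : G * PowerSeries.C e = G
  star_G : ∀ k, star (PowerSeries.coeff k G) = PowerSeries.coeff k G
  coeff_F : PowerSeries.constantCoeff F = a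
  coeff_G : PowerSeries.constantCoeff G = b

namespace IsPseudoInvPair

variable {a b e : R} {F G : PowerSeries R}

theorem inv_mul (h : IsPseudoInvPair a b e F G) :
    (F * PowerSeries.C b + PowerSeries.C (1 - e)) * (PowerSeries.C a * G + PowerSeries.C (1 - e))
      = 1 := by
  have e1 : PowerSeries.C b * PowerSeries.C a = PowerSeries.C e := by rw [← map_mul, h.ba]
  have ee : e * e = e := by
    calc e * e = e * a * b := by rw [mul_assoc, h.ab]
      _ = e := by rw [h.ea, h.ab]
  have be : b * e = b := by
    have := congrArg PowerSeries.constantCoeff h.Ge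
    simpa [h.coeff_G] using this
  have h1 : F * PowerSeries.C b * (PowerSeries.C a * G) = PowerSeries.C e := by
    rw [mul_assoc, ← mul_assoc _ _ G, e1, h.eG, h.FG]
  have h2 : F * PowerSeries.C b * PowerSeries.C (1 - e) = 0 := by
    rw [mul_assoc, ← map_mul, mul_sub, be, mul_one, sub_self, map_zero, mul_zero]
  have h3 : PowerSeries.C (1 - e) * (PowerSeries.C a * G) = 0 := by
    rw [← mul_assoc, ← map_mul, sub_mul, h.ea, one_mul, sub_self, map_zero, zero_mul]
  have h4 : (1 - e) * (1 - e) = 1 - e := by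
    rw [mul_sub, mul_one, sub_mul, one_mul, ee, sub_self, sub_zero]
  rw [mul_add, add_mul, add_mul, h1, h2, h3, add_zero, zero_add, ← map_mul, h4, ← map_add,
    add_sub_cancel, map_one]

theorem constantCoeff_eq_one (h : IsPseudoInvPair a b e F G) :
    PowerSeries.constantCoeff (PowerSeries.C a * G + PowerSeries.C (1 - e)) = 1 := by
  simp [h.coeff_G, h.ab]

/-- On the range of `e` the matrix of `G` inverts that of `F`, so `N = -T_G M T_G^T`, and the
transpose is the adjoint because `G` has self-adjoint coefficients. The summand `1 - e`, killed by
`M`, is added only to make the conjugating matrix invertible. -/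
theorem conj_eq (h : IsPseudoInvPair a b e F G) {n : ℕ} {M N : Matrix (Fin n) (Fin n) R}
    (hN : toep n F * N = -(M * (toep n G)ᵀ)) (eN : Matrix.diagonal (fun _ => e) * N = N)
    (eM : Matrix.diagonal (fun _ => e) * M = M) (Me : M * Matrix.diagonal (fun _ => e) = M) :
    -(Matrix.diagonal (fun _ => a) * N * Matrix.diagonal (fun _ => a)) =
      toep n (PowerSeries.C a * G + PowerSeries.C (1 - e)) * M *
        (toep n (PowerSeries.C a * G + PowerSeries.C (1 - e)))ᴴ := by
  have hGT : (toep n G)ᴴ = (toep n G)ᵀ := by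
    ext i j
    by_cases hij : i ≤ j <;> simp [toep, hij, h.star_G]
  have h1 : N = -(toep n G * M * (toep n G)ᵀ) := by
    rw [← eN, ← toep_C, ← h.GF, toep_mul, Matrix.mul_assoc, hN, Matrix.mul_neg, Matrix.mul_assoc]
  have d1 : (Matrix.diagonal fun _ : Fin n => (1 - e)) = 1 - Matrix.diagonal fun _ => e := by
    rw [← Matrix.diagonal_one, Matrix.diagonal_sub]
  have h2 : toep n (PowerSeries.C a * G + PowerSeries.C (1 - e)) * M =
      Matrix.diagonal (fun _ => a) * toep n G * M := by
    rw [toep_add, toep_mul, toep_C, toep_C, d1, Matrix.add_mul, Matrix.sub_mul, eM, Matrix.one_mul,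
      sub_self, add_zero]
  have h3 : M * (toep n (PowerSeries.C a * G + PowerSeries.C (1 - e)))ᴴ =
      M * (toep n G)ᵀ * Matrix.diagonal (fun _ => a) := by
    rw [toep_add, toep_mul, toep_C, toep_C, d1, Matrix.conjTranspose_add, Matrix.conjTranspose_sub,
      Matrix.conjTranspose_mul, Matrix.conjTranspose_one, Matrix.diagonal_conjTranspose,
      Matrix.diagonal_conjTranspose, hGT]
    have s1 : (star fun _ : Fin n => a) = fun _ => a := funext fun _ => h.star_a
    have s2 : (star fun _ : Fin n => e) = fun _ => e := funext fun _ => h.star_e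
    rw [s1, s2, Matrix.mul_add, Matrix.mul_sub, Me, Matrix.mul_one, sub_self, add_zero,
      Matrix.mul_assoc]
  rw [h2, Matrix.mul_assoc _ M, h3, h1]
  simp only [Matrix.mul_neg, Matrix.neg_mul, neg_neg, Matrix.mul_assoc]

/-- The Hankel matrix of `-a G_{k+1} a`. -/
theorem hank_one (h : IsPseudoInvPair a b e F G) (n : ℕ)
    (hl : ∀ k, e * PowerSeries.coeff k F = PowerSeries.coeff k F)
    (hr : ∀ k, PowerSeries.coeff k F * e = PowerSeries.coeff k F) :
    hank n (fun k => -(a * PowerSeries.coeff (k + 1) G * a)) =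
      toep n (PowerSeries.C a * G + PowerSeries.C (1 - e)) *
        hank n (fun k => PowerSeries.coeff (k + 1) F) *
        (toep n (PowerSeries.C a * G + PowerSeries.C (1 - e)))ᴴ := by
  rw [← h.conj_eq (toep_mul_hank_one h.FG)]
  · ext i j; simp [hank]
  · ext i j; simp [hank, ← PowerSeries.coeff_C_mul, h.eG]
  · ext i j; simp [hank, hl]
  · ext i j; simp [hank, hr]

/-- The Hankel matrix of `-a G_{k+2} a`. -/
theorem hank_two (h : IsPseudoInvPair a b e F G) (n : ℕ)
    (hl : ∀ k, e * PowerSeries.coeff k F = PowerSeries.coeff k F)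
    (hr : ∀ k, PowerSeries.coeff k F * e = PowerSeries.coeff k F) :
    hank n (fun k => -(a * PowerSeries.coeff (k + 2) G * a)) =
      toep n (PowerSeries.C a * G + PowerSeries.C (1 - e)) *
        hankCompl n b (fun k => PowerSeries.coeff k F) *
        (toep n (PowerSeries.C a * G + PowerSeries.C (1 - e)))ᴴ := by
  rw [← h.conj_eq (toep_mul_hank_two h.FG (by rw [h.coeff_F, h.ba]) h.eG)]
  · ext i j; simp [hank]
  · ext i j; simp [hank, ← PowerSeries.coeff_C_mul, h.eG]
  · ext i j; simp [hankCompl, hl, mul_sub, ← mul_assoc]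
  · ext i j; simp [hankCompl, hr, sub_mul, mul_assoc]

end IsPseudoInvPair

end StarRing

/-! ### Non-negative Hermitian block matrices -/

section Block

variable {q : ℕ} {ι κ : Type*}

/-- A matrix of square blocks is non-negative Hermitian. -/
def BlockPosSemidef (M : Matrix ι ι (Matrix (Fin q) (Fin q) ℂ)) : Prop :=
  (Matrix.comp ι ι (Fin q) (Fin q) ℂ M).PosSemidef

theorem comp_mul_comp {l m n : Type*} [Fintype m]
    (M : Matrix l m (Matrix (Fin q) (Fin q) ℂ)) (N : Matrix m n (Matrix (Fin q) (Fin q) ℂ)) :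
    Matrix.comp _ _ _ _ ℂ (M * N) = Matrix.comp _ _ _ _ ℂ M * Matrix.comp _ _ _ _ ℂ N := by
  ext a b
  simp [Matrix.comp_apply, Matrix.mul_apply, Matrix.sum_apply, Fintype.sum_prod_type]

theorem comp_conjTranspose_block {l m : Type*} (M : Matrix l m (Matrix (Fin q) (Fin q) ℂ)) :
    Matrix.comp _ _ _ _ ℂ Mᴴ = (Matrix.comp _ _ _ _ ℂ M)ᴴ := rfl

theorem BlockPosSemidef.conj [Fintype ι] [Fintype κ]
    {M : Matrix ι ι (Matrix (Fin q) (Fin q) ℂ)} (hM : BlockPosSemidef M)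
    (B : Matrix κ ι (Matrix (Fin q) (Fin q) ℂ)) : BlockPosSemidef (B * M * Bᴴ) := by
  unfold BlockPosSemidef
  rw [comp_mul_comp, comp_mul_comp, comp_conjTranspose_block]
  exact hM.mul_mul_conjTranspose_same _

theorem BlockPosSemidef.conjTranspose_eq {M : Matrix ι ι (Matrix (Fin q) (Fin q) ℂ)}
    (hM : BlockPosSemidef M) : Mᴴ = M :=
  (Matrix.comp ι ι (Fin q) (Fin q) ℂ).injective hM.isHermitian

theorem BlockPosSemidef.submatrix {M : Matrix ι ι (Matrix (Fin q) (Fin q) ℂ)}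
    (hM : BlockPosSemidef M) (f : κ → ι) : BlockPosSemidef (M.submatrix f f) :=
  Matrix.PosSemidef.submatrix hM (Prod.map f id)

/-- A column of blocks as a matrix. -/
def blockCol (X : ι → Matrix (Fin q) (Fin q) ℂ) : Matrix (ι × Fin q) (Fin q) ℂ :=
  Matrix.of fun a c => X a.1 a.2 c

theorem blockCol_injective :
    Function.Injective (blockCol : (ι → Matrix (Fin q) (Fin q) ℂ) → _) := by
  intro X Y h
  ext i a c
  exact congrFun (congrFun h (i, a)) c

theorem comp_mul_blockCol [Fintype ι] (M : Matrix κ ι (Matrix (Fin q) (Fin q) ℂ))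
    (X : ι → Matrix (Fin q) (Fin q) ℂ) :
    Matrix.comp _ _ _ _ ℂ M * blockCol X = blockCol (M *ᵥ X) := by
  ext a c
  simp [blockCol, Matrix.comp_apply, Matrix.mul_apply, Matrix.mulVec, dotProduct,
    Matrix.sum_apply, Fintype.sum_prod_type]

theorem conjTranspose_blockCol_mul [Fintype ι] (X Y : ι → Matrix (Fin q) (Fin q) ℂ) :
    (blockCol X)ᴴ * blockCol Y = star X ⬝ᵥ Y := by
  ext a c
  simp [blockCol, Matrix.mul_apply, dotProduct, Matrix.sum_apply, Fintype.sum_prod_type,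
    Matrix.star_eq_conjTranspose]

theorem PosSemidef.mul_eq_zero_of_conj {m n : Type*} [Fintype m]
    {M : Matrix m m ℂ} (hM : M.PosSemidef) {X : Matrix m n ℂ} (h : Xᴴ * (M * X) = 0) :
    M * X = 0 := by
  ext i c
  have h1 := (hM.dotProduct_mulVec_zero_iff fun i => X i c).1 (congrFun (congrFun h c) c)
  exact congrFun h1 i

theorem BlockPosSemidef.mulVec_eq_zero [Fintype ι] {M : Matrix ι ι (Matrix (Fin q) (Fin q) ℂ)}
    (hM : BlockPosSemidef M) {X : ι → Matrix (Fin q) (Fin q) ℂ} (h : star X ⬝ᵥ (M *ᵥ X) = 0) :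
    M *ᵥ X = 0 := by
  have h1 := PosSemidef.mul_eq_zero_of_conj hM (X := blockCol X)
    (by rw [comp_mul_blockCol, conjTranspose_blockCol_mul, h])
  rw [comp_mul_blockCol] at h1
  exact blockCol_injective h1

end Block

/-! ### Null spaces of Hankel matrices, and `L` as a Schur complement -/

section Hankel

variable {q : ℕ} {s : ℕ → Matrix (Fin q) (Fin q) ℂ}

theorem neg_smul_H_add_K (α : ℂ) (n : ℕ) : -α • H s n + K s n = H (shift α s) n := rfl

theorem BlockPosSemidef.hank_mono {k n : ℕ} (h : BlockPosSemidef (hank n s)) (hk : k ≤ n) :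
    BlockPosSemidef (hank k s) :=
  h.submatrix (Fin.castLE hk)

theorem BlockPosSemidef.hank_conjTranspose_eq {n j : ℕ} (h : BlockPosSemidef (hank (n + 1) s))
    (hj : j ≤ 2 * n) : (s j)ᴴ = s j := by
  have h1 := congrFun (congrFun h.conjTranspose_eq ⟨j / 2, by omega⟩) ⟨j - j / 2, by omega⟩
  have h2 : j / 2 + (j - j / 2) = j := by omega
  simpa [hank, Matrix.star_eq_conjTranspose, add_comm (j - j / 2), h2] using h1

/-- The block vector with `p` in slot `i` has quadratic form `p* s_{2i} p = 0`, so non-negativity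
makes the whole block column `i` annihilate `p`. -/
theorem BlockPosSemidef.hank_mul_eq_zero {n i : ℕ} (h : BlockPosSemidef (hank (n + 1) s))
    (hi : i ≤ n) {p : Matrix (Fin q) (Fin q) ℂ} (hp : s (2 * i) * p = 0) {j : ℕ} (hij : i ≤ j)
    (hj : j ≤ i + n) : s j * p = 0 := by
  let i' : Fin (n + 1) := ⟨i, by omega⟩
  have h1 : hank (n + 1) s *ᵥ Pi.single i' p = fun k : Fin (n + 1) => s (k + i) * p := by
    ext1 k
    rw [Matrix.mulVec_single]
    rfl
  have h2 := h.mulVec_eq_zero (X := Pi.single i' p) (by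
    rw [h1, ← Pi.single_star, single_dotProduct]
    simp only [i', ← two_mul, hp, mul_zero])
  rw [h1] at h2
  have := congrFun h2 ⟨j - i, by omega⟩
  simpa [Nat.sub_add_cancel hij] using this

/-- If `H_n` is non-negative Hermitian, then the null space of `s_0` is contained in the null
spaces of `s_1, ..., s_{2n-1}`. -/
theorem BlockPosSemidef.hank_mul_eq_zero_of_zero {n : ℕ} (h : BlockPosSemidef (hank (n + 1) s))
    {p : Matrix (Fin q) (Fin q) ℂ} (hp : s 0 * p = 0) {j : ℕ} (hj : j < 2 * n) : s j * p = 0 := by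
  have even : ∀ i, i < n → s (2 * i) * p = 0 := by
    intro i
    induction i with
    | zero => intro _; simpa using hp
    | succ i ih =>
      intro hi
      exact h.hank_mul_eq_zero (by omega) (ih (by omega)) (by omega) (by omega)
  rcases Nat.even_or_odd' j with ⟨i, rfl | rfl⟩
  · exact even i (by omega)
  · exact h.hank_mul_eq_zero (i := i) (by omega) (even i (by omega)) (by omega) (by omega)

/-- A block row put below a block column. -/
def snocBlock {κ : Type*} {n : ℕ} (X : Matrix (Fin n × Fin q) κ ℂ) (Z : Matrix (Fin q) κ ℂ) :
    Matrix (Fin (n + 1) × Fin q) κ ℂ :=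
  Matrix.of fun a c => Fin.lastCases (motive := fun _ => ℂ) (Z a.2 c) (fun i => X (i, a.2) c) a.1

theorem H_succ_mul_snocBlock {κ : Type*} (n : ℕ) (X : Matrix (Fin (n + 1) × Fin q) κ ℂ)
    (Z : Matrix (Fin q) κ ℂ) :
    H s (n + 1) * snocBlock X Z =
      snocBlock (H s n * X + yCol s (n + 1) (n + 1) * Z)
        (zRow s (n + 1) (n + 1) * X + s (2 * (n + 1)) * Z) := by
  ext ⟨i, a⟩ c
  induction i using Fin.lastCases with
  | last =>
    simp [snocBlock, Matrix.mul_apply, Fintype.sum_prod_type, Fin.sum_univ_castSucc, H, zRow,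
      two_mul]
  | cast i =>
    simp [snocBlock, Matrix.mul_apply, Fintype.sum_prod_type, Fin.sum_univ_castSucc, H, yCol,
      add_comm]

theorem conjTranspose_snocBlock_mul {κ l : Type*} {n : ℕ} (X : Matrix (Fin n × Fin q) κ ℂ)
    (Z : Matrix (Fin q) κ ℂ) (X' : Matrix (Fin n × Fin q) l ℂ) (Z' : Matrix (Fin q) l ℂ) :
    (snocBlock X Z)ᴴ * snocBlock X' Z' = Xᴴ * X' + Zᴴ * Z' := by
  ext a c
  simp [snocBlock, Matrix.mul_apply, Fintype.sum_prod_type, Fin.sum_univ_castSucc]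

theorem BlockPosSemidef.isSchurCompl_L {n : ℕ} (h : BlockPosSemidef (hank (n + 1) s)) :
    IsSchurCompl (hank (n + 1) s) (L s n) := by
  cases n with
  | zero =>
    refine ⟨fun _ => 1, rfl, ?_⟩
    ext1 i
    obtain rfl : i = Fin.last 0 := Fin.ext (by have := i.2; simp)
    simp [Matrix.mulVec, dotProduct, hank, L]
  | succ n =>
    obtain ⟨m1, -, m3, -⟩ := mpInv_spec (H s n)
    set G := mpInv (H s n) with hG
    set Y := yCol s (n + 1) (n + 1) with hY
    have hH : (H s n)ᴴ = H s n := (h.hank_mono (k := n + 1) (by omega)).isHermitian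
    -- the column lies in the range of the leading part
    have hr : H s n * G * Y = Y := by
      set E := 1 - H s n * G with hE
      have EH : Eᴴ = E := by rw [hE, Matrix.conjTranspose_sub, m3, Matrix.conjTranspose_one]
      have E0 : E * H s n = 0 := by rw [hE, Matrix.sub_mul, m1, Matrix.one_mul, sub_self]
      have HE : H s n * E = 0 := by
        have := congrArg Matrix.conjTranspose E0
        rwa [Matrix.conjTranspose_mul, hH, EH, Matrix.conjTranspose_zero] at this
      have h1 := H_succ_mul_snocBlock (s := s) n E (0 : Matrix (Fin q) _ ℂ)
      -- The quadratic form at `(E; 0)` is `E* H_n E = 0`, so `H_{n+1}` annihilates this block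
      -- column; its bottom row gives `h3`.
      have h2 := PosSemidef.mul_eq_zero_of_conj (M := H s (n + 1)) h
        (X := snocBlock E (0 : Matrix (Fin q) _ ℂ)) (by
          rw [h1, conjTranspose_snocBlock_mul, HE]; simp)
      have h3 : zRow s (n + 1) (n + 1) * E = 0 := by
        ext a c
        have := congrFun (congrFun (h1.symm.trans h2) (Fin.last (n + 1), a)) c
        simpa [snocBlock] using this
      have hz : (zRow s (n + 1) (n + 1))ᴴ = Y := by
        ext ⟨i, a⟩ c
        have := h.hank_conjTranspose_eq (j := n + 1 + i) (by omega)
        exact congrFun (congrFun this a) c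
      have h4 := congrArg Matrix.conjTranspose h3
      rw [Matrix.conjTranspose_mul, hz, EH, Matrix.conjTranspose_zero, hE, Matrix.sub_mul,
        Matrix.one_mul, sub_eq_zero] at h4
      exact h4.symm
    -- By `hr` the upper blocks of `H_{n+1} W` cancel, and the last one is `L_{n+1}`.
    set W := snocBlock (-(G * Y)) (1 : Matrix (Fin q) (Fin q) ℂ) with hW
    refine ⟨fun i => Matrix.of fun a c => W (i, a) c, ?_, ?_⟩
    · ext a c
      simp [hW, snocBlock]
    · apply blockCol_injective
      rw [← comp_mul_blockCol]
      change H s (n + 1) * W = _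
      rw [hW, H_succ_mul_snocBlock, Matrix.mul_neg, ← Matrix.mul_assoc, hr, Matrix.mul_one,
        neg_add_cancel]
      ext ⟨i, a⟩ c
      induction i using Fin.lastCases with
      | last =>
        simp only [snocBlock, blockCol, Matrix.of_apply, Fin.lastCases_last, Pi.single_eq_same, L]
        rw [Matrix.mul_neg, Matrix.mul_one, ← Matrix.mul_assoc, neg_add_eq_sub]
      | cast i =>
        simp [snocBlock, blockCol]

end Hankel

/-! ### The Schur step for sequences with ranges in that of the first entry -/

section Reduced

variable {q : ℕ}

theorem mpInv_conjTranspose_of_isHermitian {A : Matrix (Fin q) (Fin q) ℂ} (hA : Aᴴ = A) :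
    (mpInv A)ᴴ = mpInv A := by
  obtain ⟨h1, h2, h3, h4⟩ := mpInv_spec A
  refine IsMoorePenrose.unique (A := A) ⟨?_, ?_, ?_, ?_⟩ ⟨h1, h2, h3, h4⟩
  · simpa [Matrix.conjTranspose_mul, hA, Matrix.mul_assoc] using congrArg Matrix.conjTranspose h1
  · simpa [Matrix.conjTranspose_mul, hA, Matrix.mul_assoc] using congrArg Matrix.conjTranspose h2
  · rw [Matrix.conjTranspose_mul, Matrix.conjTranspose_conjTranspose, hA, ← h4,
      Matrix.conjTranspose_mul, hA]
  · rw [Matrix.conjTranspose_mul, Matrix.conjTranspose_conjTranspose, hA, ← h3,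
      Matrix.conjTranspose_mul, hA]

theorem mpInv_mul_comm_of_isHermitian {A : Matrix (Fin q) (Fin q) ℂ} (hA : Aᴴ = A) :
    mpInv A * A = A * mpInv A := by
  have h3 := (mpInv_spec A).2.2.1
  rw [← h3, Matrix.conjTranspose_mul, hA, mpInv_conjTranspose_of_isHermitian hA]

/-- A sequence of Hermitian matrices with ranges in the range of the first one. -/
structure IsReduced (s : ℕ → Matrix (Fin q) (Fin q) ℂ) : Prop where
  herm : ∀ j, (s j)ᴴ = s j
  proj : ∀ j, s 0 * mpInv (s 0) * s j = s j

variable {s : ℕ → Matrix (Fin q) (Fin q) ℂ}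

theorem IsReduced.proj_right (h : IsReduced s) (j : ℕ) : s j * (s 0 * mpInv (s 0)) = s j := by
  have := congrArg Matrix.conjTranspose (h.proj j)
  rwa [Matrix.conjTranspose_mul, h.herm j, (mpInv_spec (s 0)).2.2.1] at this

theorem plusTransform_zero (α : ℂ) (s : ℕ → Matrix (Fin q) (Fin q) ℂ) :
    plusTransform α s 0 = s 0 := rfl

theorem IsReduced.plus (h : IsReduced s) (α : ℝ) :
    IsReduced (plusTransform (α : ℂ) s) := by
  refine ⟨fun j => ?_, fun j => ?_⟩
  · cases j with
    | zero => exact h.herm 0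
    | succ j => simp [plusTransform, h.herm]
  · rw [plusTransform_zero]
    cases j with
    | zero => exact h.proj 0
    | succ j => simp only [plusTransform, Matrix.mul_add, Matrix.mul_smul, h.proj]

theorem reciprocal_zero (s : ℕ → Matrix (Fin q) (Fin q) ℂ) : reciprocal s 0 = mpInv (s 0) := by
  rw [reciprocal]

theorem reciprocal_succ (s : ℕ → Matrix (Fin q) (Fin q) ℂ) (j : ℕ) :
    reciprocal s (j + 1) =
      -(mpInv (s 0) * ∑ l ∈ Finset.range (j + 1), s (j + 1 - l) * reciprocal s l) := by
  rw [reciprocal, Fin.sum_univ_eq_sum_range (fun l => s (j + 1 - l) * reciprocal s l)]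

/-- The recursion for the reciprocal sequence is `FG = e`. Taking adjoints of coefficients gives
`G*F = e`, whence `G* = G*e = G*FG = eG = G`, which yields both `GF = e` and self-adjointness. -/
theorem IsReduced.isPseudoInvPair (h : IsReduced s) :
    IsPseudoInvPair (s 0) (mpInv (s 0)) (s 0 * mpInv (s 0)) (PowerSeries.mk s)
      (PowerSeries.mk (reciprocal s)) := by
  have hab := mpInv_mul_comm_of_isHermitian (h.herm 0)
  obtain ⟨m1, m2, m3, m4⟩ := mpInv_spec (s 0)
  set b := mpInv (s 0) with hb
  set e := s 0 * b with he
  have hFG : PowerSeries.mk s * PowerSeries.mk (reciprocal s) = PowerSeries.C e := by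
    ext1 n
    rw [PowerSeries.coeff_mul, ← Finset.Nat.sum_antidiagonal_swap,
      Finset.Nat.sum_antidiagonal_eq_sum_range_succ_mk]
    simp only [Prod.fst_swap, Prod.snd_swap, PowerSeries.coeff_mk, PowerSeries.coeff_C]
    cases n with
    | zero => simp [reciprocal_zero, he, hb]
    | succ n =>
      rw [Finset.sum_range_succ, Nat.sub_self, reciprocal_succ, Matrix.mul_neg, ← Matrix.mul_assoc,
        ← hb, ← he, Finset.mul_sum, ← sub_eq_add_neg,
        if_neg (Nat.succ_ne_zero n), sub_eq_zero]
      exact Finset.sum_congr rfl fun k _ => by rw [← Matrix.mul_assoc, h.proj]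
  have eb : e * b = b := by rw [← hab, m2]
  have er : ∀ k, e * reciprocal s k = reciprocal s k := by
    intro k
    cases k with
    | zero => rw [reciprocal_zero, ← hb, eb]
    | succ k => rw [reciprocal_succ, ← hb, Matrix.mul_neg, ← Matrix.mul_assoc, eb]
  have hGF : PowerSeries.mk (fun k => (reciprocal s k)ᴴ) * PowerSeries.mk s =
      PowerSeries.C e := by
    ext1 n
    have h1 := congrArg (fun x => (PowerSeries.coeff n x)ᴴ) hFG
    simp only [PowerSeries.coeff_mul, PowerSeries.coeff_mk, Matrix.conjTranspose_sum,
      Matrix.conjTranspose_mul, h.herm, PowerSeries.coeff_C] at h1 ⊢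
    rw [← Finset.Nat.sum_antidiagonal_swap]
    simp only [Prod.fst_swap, Prod.snd_swap, h1]
    split_ifs <;> simp [m3]
  have eG : PowerSeries.C e * PowerSeries.mk (reciprocal s) = PowerSeries.mk (reciprocal s) := by
    ext1 n
    rw [PowerSeries.coeff_C_mul, PowerSeries.coeff_mk, er]
  have Ge : PowerSeries.mk (fun k => (reciprocal s k)ᴴ) * PowerSeries.C e =
      PowerSeries.mk (fun k => (reciprocal s k)ᴴ) := by
    ext1 n
    rw [PowerSeries.coeff_mul_C, PowerSeries.coeff_mk]
    conv_rhs => rw [← er, Matrix.conjTranspose_mul, m3]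
  have hr : PowerSeries.mk (fun k => (reciprocal s k)ᴴ) = PowerSeries.mk (reciprocal s) := by
    rw [← Ge, ← hFG, ← mul_assoc, hGF, eG]
  rw [hr] at hGF Ge
  exact ⟨rfl, hab, m1, h.herm 0, m3, hFG, hGF, eG, Ge,
    fun k => by
      simpa [Matrix.star_eq_conjTranspose] using congrArg (PowerSeries.coeff k) hr, by simp,
    by simp [reciprocal_zero, hb]⟩

theorem mk_plusTransform (α : ℂ) (s : ℕ → Matrix (Fin q) (Fin q) ℂ) :
    PowerSeries.mk (plusTransform α s) = (1 - α • PowerSeries.X) * PowerSeries.mk s := by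
  ext1 n
  rw [sub_mul, one_mul, smul_mul_assoc]
  cases n with
  | zero => simp [plusTransform]
  | succ n =>
    rw [map_sub, PowerSeries.coeff_smul, PowerSeries.coeff_succ_X_mul]
    simp [plusTransform, sub_eq_neg_add]

theorem mk_mul_one_sub (α : ℂ) (s : ℕ → Matrix (Fin q) (Fin q) ℂ) :
    (1 - α • PowerSeries.X) * PowerSeries.mk s = PowerSeries.mk s * (1 - α • PowerSeries.X) := by
  rw [sub_mul, mul_sub, one_mul, mul_one, smul_mul_assoc, mul_smul_comm, PowerSeries.X_mul]

/-- The scalar factor `1 - αz` is central: if `G'` is reciprocal to `(1 - αz)F`, then `(1 - αz)G'`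
is reciprocal to `F`, and left multiplication by `G` gives uniqueness. -/
theorem IsReduced.reciprocal_eq (h : IsReduced s) (α : ℝ) :
    reciprocal s = plusTransform (α : ℂ) (reciprocal (plusTransform (α : ℂ) s)) := by
  have p := h.isPseudoInvPair
  have p' := (h.plus α).isPseudoInvPair
  rw [plusTransform_zero] at p'
  have h1 : PowerSeries.mk s *
      PowerSeries.mk (plusTransform (α : ℂ) (reciprocal (plusTransform (α : ℂ) s))) =
      PowerSeries.C (s 0 * mpInv (s 0)) := by
    rw [mk_plusTransform _ (reciprocal _), ← mul_assoc, ← mk_mul_one_sub, ← mk_plusTransform, p'.FG]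
  have h2 := congrArg (fun x => PowerSeries.mk (reciprocal s) * x) h1
  rw [← mul_assoc, p.GF, p.Ge, mk_plusTransform, mk_mul_one_sub, ← mul_assoc, p'.eG,
    ← mk_mul_one_sub, ← mk_plusTransform] at h2
  funext n
  simpa using (congrArg (PowerSeries.coeff n) h2).symm

theorem schurStep_eq (α : ℂ) (s : ℕ → Matrix (Fin q) (Fin q) ℂ) :
    schurStep α s = fun k => -(s 0 *
      PowerSeries.coeff (k + 1) (PowerSeries.mk (reciprocal (plusTransform α s))) * s 0) := by
  funext k
  simp [schurStep]

theorem IsReduced.shift_schurStep_eq (h : IsReduced s) (α : ℝ) :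
    shift (α : ℂ) (schurStep (α : ℂ) s) = fun k => -(s 0 *
      PowerSeries.coeff (k + 2) (PowerSeries.mk (reciprocal s)) * s 0) := by
  funext k
  rw [h.reciprocal_eq α]
  simp [shift, schurStep, plusTransform, Matrix.mul_add, Matrix.add_mul, add_comm]

theorem IsReduced.schurStep_of_shift (h : IsReduced s) (α : ℝ) {n : ℕ}
    (hn : BlockPosSemidef (hank (n + 1) (shift (α : ℂ) s))) :
    BlockPosSemidef (hank (n + 1) (schurStep (α : ℂ) s)) ∧
      L (schurStep (α : ℂ) s) n = L (shift (α : ℂ) s) n := by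
  have p := (h.plus α).isPseudoInvPair
  have h1 := p.hank_one (n + 1) (by simpa using (h.plus α).proj)
    (by simpa using (h.plus α).proj_right)
  rw [plusTransform_zero, ← schurStep_eq] at h1
  have h2 : (fun k => PowerSeries.coeff (k + 1)
      (PowerSeries.mk (plusTransform (α : ℂ) s))) = shift (α : ℂ) s := by
    funext k
    simp [plusTransform, shift]
  rw [h2] at h1
  have h3 : BlockPosSemidef (hank (n + 1) (schurStep (α : ℂ) s)) := by
    rw [h1]; exact hn.conj _
  refine ⟨h3, IsSchurCompl.unique h3.conjTranspose_eq h3.isSchurCompl_L ?_⟩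
  rw [h1]
  exact hn.isSchurCompl_L.toep_conj p.inv_mul p.constantCoeff_eq_one

theorem IsReduced.hankCompl_posSemidef (h : IsReduced s) {n : ℕ}
    (hn : BlockPosSemidef (hank (n + 1) s)) : BlockPosSemidef (hankCompl n (mpInv (s 0)) s) := by
  -- The block Gauss elimination of the first column, with its first row dropped.
  let B : Matrix (Fin n) (Fin (n + 1)) (Matrix (Fin q) (Fin q) ℂ) :=
    Matrix.of fun i => Fin.cons (-(s (i + 1) * mpInv (s 0))) (Pi.single i 1)
  have h0 := mpInv_mul_comm_of_isHermitian (h.herm 0)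
  have h1 : ∀ i k, (B * hank (n + 1) s) i k = s (i + 1 + k) - s (i + 1) * mpInv (s 0) * s k := by
    intro i k
    rw [Matrix.mul_apply, Fin.sum_univ_succ, Finset.sum_eq_single i]
    · simp [B, hank, sub_eq_neg_add]
    · intro j _ hj; simp [B, hj]
    · simp
  have h2 : B * hank (n + 1) s * Bᴴ = hankCompl n (mpInv (s 0)) s := by
    ext1 i j
    rw [Matrix.mul_apply, Fin.sum_univ_succ, Finset.sum_eq_single j]
    · simp only [h1, Matrix.conjTranspose_apply]
      simp [B, hankCompl, Matrix.mul_assoc, h0, h.proj_right]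
      congr 1
      omega
    · intro k _ hk; simp [B, hk]
    · simp
  rw [← h2]
  exact hn.conj B

theorem IsReduced.shift_schurStep_of_hank (h : IsReduced s) (α : ℝ) {n : ℕ}
    (hn : BlockPosSemidef (hank (n + 2) s)) :
    BlockPosSemidef (hank (n + 1) (shift (α : ℂ) (schurStep (α : ℂ) s))) ∧
      L (shift (α : ℂ) (schurStep (α : ℂ) s)) n = L s (n + 1) := by
  have p := h.isPseudoInvPair
  have h1 := p.hank_two (n + 1) (by simpa using h.proj) (by simpa using h.proj_right)
  rw [← h.shift_schurStep_eq α] at h1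
  simp only [PowerSeries.coeff_mk] at h1
  have h3 : BlockPosSemidef (hank (n + 1) (shift (α : ℂ) (schurStep (α : ℂ) s))) := by
    rw [h1]; exact (h.hankCompl_posSemidef hn).conj _
  refine ⟨h3, IsSchurCompl.unique h3.conjTranspose_eq h3.isSchurCompl_L ?_⟩
  rw [h1]
  exact (hn.isSchurCompl_L.hankCompl p.ba h.proj_right).toep_conj p.inv_mul p.constantCoeff_eq_one

end Reduced

/-! ### Dependence on the last matrix of the sequence -/

section Congr

variable {q : ℕ} {f g : ℕ → Matrix (Fin q) (Fin q) ℂ}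

theorem H_congr {n : ℕ} (h : ∀ j ≤ 2 * n, f j = g j) : H f n = H g n := by
  ext a b
  simp only [H, Matrix.of_apply]
  rw [h _ (by omega)]

theorem shift_congr (α : ℂ) {m : ℕ} (h : ∀ j ≤ m + 1, f j = g j) :
    ∀ j ≤ m, shift α f j = shift α g j := by
  intro j hj
  rw [shift, shift, h j (by omega), h (j + 1) (by omega)]

theorem L_congr {n : ℕ} (h : ∀ j < 2 * n, f j = g j) :
    L f n = L g n + (f (2 * n) - g (2 * n)) := by
  cases n with
  | zero => simp [L]
  | succ n =>
    have h1 : H f n = H g n := H_congr fun j hj => h j (by omega)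
    have h2 : zRow f (n + 1) (n + 1) = zRow g (n + 1) (n + 1) := by
      ext a b
      simp only [zRow, Matrix.of_apply]
      rw [h _ (by omega)]
    have h3 : yCol f (n + 1) (n + 1) = yCol g (n + 1) (n + 1) := by
      ext a b
      simp only [yCol, Matrix.of_apply]
      rw [h _ (by omega)]
    rw [L, L, h1, h2, h3]
    abel

theorem Q_even (α : ℂ) (f : ℕ → Matrix (Fin q) (Fin q) ℂ) (n : ℕ) : Q α f (2 * n) = L f n := by
  simp [Q]

theorem Q_odd (α : ℂ) (f : ℕ → Matrix (Fin q) (Fin q) ℂ) (n : ℕ) :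
    Q α f (2 * n + 1) = L (shift α f) n := by
  have : (2 * n + 1) / 2 = n := by omega
  simp [Q, this]

theorem Q_congr (α : ℂ) {j : ℕ} (h : ∀ k < j, f k = g k) : Q α f j = Q α g j + (f j - g j) := by
  rcases Nat.even_or_odd' j with ⟨n, rfl | rfl⟩
  · rw [Q_even, Q_even, L_congr h]
  · rw [Q_odd, Q_odd, L_congr (f := shift α f) (g := shift α g) fun k hk => ?_]
    · simp [shift, h]
    · rw [shift, shift, h k (by omega), h (k + 1) (by omega)]

theorem IsStieltjesNonneg.congr {α : ℝ} {m : ℕ} (h : ∀ j ≤ m, f j = g j)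
    (hf : IsStieltjesNonneg α m f) : IsStieltjesNonneg α m g := by
  refine ⟨?_, fun hm => ?_⟩
  · rw [← H_congr fun j hj => h j (by omega)]
    exact hf.1
  · have := hf.2 hm
    rw [neg_smul_H_add_K] at this ⊢
    rwa [← H_congr fun j hj => shift_congr α (m := m - 1) (fun k hk => h k (by omega)) j (by omega)]

theorem reciprocal_congr {m : ℕ} (h : ∀ j ≤ m, f j = g j) :
    ∀ j ≤ m, reciprocal f j = reciprocal g j := by
  intro j
  induction j using Nat.strong_induction_on with
  | _ j ih =>
    intro hj
    cases j with
    | zero => rw [reciprocal_zero, reciprocal_zero, h 0 hj]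
    | succ j =>
      rw [reciprocal_succ, reciprocal_succ, h 0 (by omega)]
      congr 2
      refine Finset.sum_congr rfl fun l hl => ?_
      have := Finset.mem_range.1 hl
      rw [h _ (by omega), ih l (by omega) (by omega)]

/-- The entry of index `m + 1` occurs only in the summand `l = 0`, between two copies of the inverse
of the first entry. -/
theorem reciprocal_succ_congr {m : ℕ} (h : ∀ j ≤ m, f j = g j)
    (h' : mpInv (g 0) * f (m + 1) * mpInv (g 0) = mpInv (g 0) * g (m + 1) * mpInv (g 0)) :
    reciprocal f (m + 1) = reciprocal g (m + 1) := by
  rw [reciprocal_succ, reciprocal_succ, Finset.sum_range_succ', Finset.sum_range_succ',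
    h 0 (Nat.zero_le _), Matrix.mul_add, Matrix.mul_add, Nat.sub_zero, reciprocal_zero,
    reciprocal_zero, h 0 (Nat.zero_le _), ← Matrix.mul_assoc, ← Matrix.mul_assoc, h']
  congr 3
  refine Finset.sum_congr rfl fun l hl => ?_
  have := Finset.mem_range.1 hl
  rw [h _ (by omega), reciprocal_congr h _ (by omega)]

theorem plusTransform_congr (α : ℂ) {m : ℕ} (h : ∀ j ≤ m, f j = g j) :
    ∀ j ≤ m, plusTransform α f j = plusTransform α g j := by
  intro j hj
  cases j with
  | zero => exact h 0 hj
  | succ j => rw [plusTransform, plusTransform, h j (by omega), h _ hj]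

theorem schurStep_congr (α : ℂ) {m : ℕ} (h : ∀ j ≤ m, f j = g j)
    (h' : mpInv (g 0) * f (m + 1) * mpInv (g 0) = mpInv (g 0) * g (m + 1) * mpInv (g 0)) :
    ∀ j ≤ m, schurStep α f j = schurStep α g j := by
  intro j hj
  have h1 := plusTransform_congr α h
  rw [schurStep, schurStep, h 0 (Nat.zero_le _)]
  rcases hj.lt_or_eq with hj | rfl
  · rw [reciprocal_congr h1 _ hj]
  · rw [reciprocal_succ_congr h1]
    simp only [plusTransform, h j le_rfl, Matrix.mul_add, Matrix.add_mul, h']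

end Congr

/-! ### Compression to the range of `s_0` and the induction -/

section Main

variable {q : ℕ} {α : ℝ} {s : ℕ → Matrix (Fin q) (Fin q) ℂ}

theorem IsStieltjesNonneg.hank_posSemidef {m n : ℕ} (h : IsStieltjesNonneg α m s)
    (hn : 2 * n ≤ m) : BlockPosSemidef (hank (n + 1) s) :=
  BlockPosSemidef.hank_mono (n := m / 2 + 1) h.1 (by omega)

theorem IsStieltjesNonneg.hank_shift_posSemidef {m n : ℕ} (h : IsStieltjesNonneg α m s)
    (hn : 2 * n + 1 ≤ m) : BlockPosSemidef (hank (n + 1) (shift (α : ℂ) s)) :=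
  BlockPosSemidef.hank_mono (n := (m - 1) / 2 + 1) (h.2 (by omega)) (by omega)

theorem IsStieltjesNonneg.conjTranspose_eq {m j : ℕ} (h : IsStieltjesNonneg α m s) (hj : j ≤ m) :
    (s j)ᴴ = s j := by
  rcases Nat.even_or_odd' j with ⟨n, rfl | rfl⟩
  · exact (h.hank_posSemidef hj).hank_conjTranspose_eq le_rfl
  · have h1 := (h.hank_shift_posSemidef hj).hank_conjTranspose_eq le_rfl
    have h2 := (h.hank_posSemidef (n := n) (by omega)).hank_conjTranspose_eq le_rfl
    simpa [shift, h2] using h1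

/-- The null space of `s_0` is contained in the null spaces of `s_1, ..., s_{m-1}`. -/
theorem IsStieltjesNonneg.mul_eq_zero {m j : ℕ} (h : IsStieltjesNonneg α m s) (hj : j < m)
    {p : Matrix (Fin q) (Fin q) ℂ} (hp : s 0 * p = 0) : s j * p = 0 := by
  by_cases h1 : j < 2 * (m / 2)
  · exact (h.hank_posSemidef (n := m / 2) (by omega)).hank_mul_eq_zero_of_zero hp h1
  -- Only `j = m - 1 = 2n` remains, out of reach of `H_n`; it is the newest term of the shifted
  -- sequence at index `2n - 1`.
  · obtain ⟨n, rfl⟩ : ∃ n, m = 2 * n + 1 := ⟨m / 2, by omega⟩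
    obtain rfl : j = 2 * n := by omega
    have h2 : ∀ k, k < 2 * n → s k * p = 0 := fun k hk =>
      (h.hank_posSemidef (n := n) (by omega)).hank_mul_eq_zero_of_zero hp hk
    rcases Nat.eq_zero_or_pos n with rfl | hn
    · exact hp
    · have h3 : shift (α : ℂ) s 0 * p = 0 := by
        simp [shift, Matrix.add_mul, hp, h2 1 (by omega)]
      have h4 := (h.hank_shift_posSemidef (n := n) le_rfl).hank_mul_eq_zero_of_zero h3
        (j := 2 * n - 1) (by omega)
      simpa [shift, Matrix.add_mul, h2 (2 * n - 1) (by omega),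
        Nat.sub_add_cancel (show 1 ≤ 2 * n by omega)] using h4

/-- The step exchanges the two Hankel families, which is why even and odd parameters alternate. -/
theorem IsReduced.isStieltjesNonneg_schurStep (hr : IsReduced s) {m : ℕ}
    (h : IsStieltjesNonneg α (m + 1) s) :
    IsStieltjesNonneg α m (schurStep (α : ℂ) s) ∧
      ∀ j ≤ m, Q (α : ℂ) (schurStep (α : ℂ) s) j = Q (α : ℂ) s (j + 1) := by
  have h1 : ∀ n, 2 * n ≤ m → _ := fun n hn =>
    hr.schurStep_of_shift α (h.hank_shift_posSemidef (n := n) (by omega))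
  have h2 : ∀ n, 2 * n + 1 ≤ m → _ := fun n hn =>
    hr.shift_schurStep_of_hank α (h.hank_posSemidef (n := n + 1) (by omega))
  refine ⟨⟨(h1 (m / 2) (by omega)).1, fun hm => (h2 ((m - 1) / 2) (by omega)).1⟩, fun j hj => ?_⟩
  rcases Nat.even_or_odd' j with ⟨n, rfl | rfl⟩
  · rw [Q_even, Q_odd, (h1 n hj).2]
  · rw [Q_odd, show 2 * n + 1 + 1 = 2 * (n + 1) by ring, Q_even, (h2 n hj).2]

/-- The sequence `s_0, ..., s_m`, compressed to the range of `s_0` and continued by zero. -/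
def compress (m : ℕ) (s : ℕ → Matrix (Fin q) (Fin q) ℂ) : ℕ → Matrix (Fin q) (Fin q) ℂ :=
  fun j => if j ≤ m then s 0 * mpInv (s 0) * s j * (s 0 * mpInv (s 0)) else 0

theorem compress_of_le {m j : ℕ} (hj : j ≤ m) :
    compress m s j = s 0 * mpInv (s 0) * s j * (s 0 * mpInv (s 0)) := if_pos hj

theorem IsStieltjesNonneg.compress_eq {m j : ℕ} (h : IsStieltjesNonneg α m s) (hj : j < m) :
    compress m s j = s j := by
  have m1 := (mpInv_spec (s 0)).1
  have m3 := (mpInv_spec (s 0)).2.2.1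
  have h0 : s 0 * (1 - s 0 * mpInv (s 0)) = 0 := by
    have := congrArg Matrix.conjTranspose m1
    rw [Matrix.conjTranspose_mul, m3, h.conjTranspose_eq (Nat.zero_le _)] at this
    rw [Matrix.mul_sub, this, Matrix.mul_one, sub_self]
  have h1 : s j * (s 0 * mpInv (s 0)) = s j := by
    have := h.mul_eq_zero hj h0
    rw [Matrix.mul_sub, Matrix.mul_one, sub_eq_zero] at this
    exact this.symm
  have h2 := congrArg Matrix.conjTranspose h1
  rw [Matrix.conjTranspose_mul, m3, h.conjTranspose_eq hj.le] at h2
  rw [compress_of_le hj.le, h2, h1]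

theorem compress_zero (h : (s 0)ᴴ = s 0) (m : ℕ) : compress m s 0 = s 0 := by
  rw [compress_of_le (Nat.zero_le _), (mpInv_spec (s 0)).1, ← mpInv_mul_comm_of_isHermitian h,
    ← Matrix.mul_assoc, (mpInv_spec (s 0)).1]

theorem IsStieltjesNonneg.isReduced_compress {m : ℕ} (h : IsStieltjesNonneg α m s) :
    IsReduced (compress m s) := by
  have m1 := (mpInv_spec (s 0)).1
  have m3 := (mpInv_spec (s 0)).2.2.1
  refine ⟨fun j => ?_, fun j => ?_⟩
  · by_cases hj : j ≤ m
    · rw [compress_of_le hj, Matrix.conjTranspose_mul, m3, Matrix.conjTranspose_mul _ (s j), m3,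
        h.conjTranspose_eq hj, Matrix.mul_assoc _ (s j)]
    · simp [compress, hj]
  · rw [compress_zero (h.conjTranspose_eq (Nat.zero_le _))]
    by_cases hj : j ≤ m
    · rw [compress_of_le hj]
      simp only [← Matrix.mul_assoc, m1]
    · simp [compress, hj]

theorem IsStieltjesNonneg.compress {m : ℕ} (h : IsStieltjesNonneg α m s) :
    IsStieltjesNonneg α m (compress m s) := by
  have m3 := (mpInv_spec (s 0)).2.2.1
  have key : ∀ {n : ℕ} {f g : ℕ → Matrix (Fin q) (Fin q) ℂ}, BlockPosSemidef (hank (n + 1) f) →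
      (∀ j ≤ 2 * n, g j = s 0 * mpInv (s 0) * f j * (s 0 * mpInv (s 0))) →
      BlockPosSemidef (hank (n + 1) g) := by
    intro n f g hf hg
    have := hf.conj (Matrix.diagonal fun _ => s 0 * mpInv (s 0))
    convert this using 1
    ext1 i j
    rw [Matrix.diagonal_conjTranspose, Matrix.mul_diagonal, Matrix.diagonal_mul]
    simp only [Pi.star_apply, Matrix.star_eq_conjTranspose, m3, hank, Matrix.of_apply]
    exact hg _ (by omega)
  refine ⟨key h.1 fun j hj => compress_of_le (by omega), fun hm => ?_⟩
  refine key (f := shift (α : ℂ) s) (g := shift (α : ℂ) (AlphaStieltjes.compress m s)) (h.2 hm)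
    fun j hj => ?_
  simp only [shift, compress_of_le (show j ≤ m by omega), compress_of_le (show j + 1 ≤ m by omega),
    Matrix.mul_add, Matrix.add_mul, Matrix.mul_smul, Matrix.smul_mul]

theorem IsStieltjesNonneg.schurStep {m : ℕ} (h : IsStieltjesNonneg α (m + 1) s) :
    IsStieltjesNonneg α m (schurStep (α : ℂ) s) ∧
      (∀ j < m, Q (α : ℂ) (AlphaStieltjes.schurStep (α : ℂ) s) j = Q (α : ℂ) s (j + 1)) ∧
      Q (α : ℂ) s (m + 1) =
        Q (α : ℂ) (AlphaStieltjes.schurStep (α : ℂ) s) m + P (α : ℂ) s (m + 1) 0 := by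
  set t := AlphaStieltjes.compress (m + 1) s with ht
  have m1 := (mpInv_spec (s 0)).1
  have m2 := (mpInv_spec (s 0)).2.1
  have h0 := h.conjTranspose_eq (Nat.zero_le _)
  have hc := mpInv_mul_comm_of_isHermitian h0
  have hlt : ∀ j ≤ m, t j = s j := fun j hj => h.compress_eq (by omega)
  have hlast : t (m + 1) = s 0 * mpInv (s 0) * s (m + 1) * (s 0 * mpInv (s 0)) :=
    compress_of_le le_rfl
  -- The transform does not see the compression, because `b (e s_{m+1} e) b = b s_{m+1} b`.
  have hstep := schurStep_congr (α : ℂ) hlt (by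
    rw [hlast]
    calc mpInv (s 0) * (s 0 * mpInv (s 0) * s (m + 1) * (s 0 * mpInv (s 0))) * mpInv (s 0)
        = (mpInv (s 0) * s 0 * mpInv (s 0)) * s (m + 1) * (s 0 * mpInv (s 0) * mpInv (s 0)) := by
          simp only [Matrix.mul_assoc]
      _ = mpInv (s 0) * s (m + 1) * mpInv (s 0) := by rw [← hc, m2])
  obtain ⟨h1, h2⟩ := h.isReduced_compress.isStieltjesNonneg_schurStep h.compress
  have h3 : ∀ j ≤ m, Q (α : ℂ) (AlphaStieltjes.schurStep (α : ℂ) s) j = Q (α : ℂ) t (j + 1) := by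
    intro j hj
    rw [← h2 j hj, Q_congr (α : ℂ) fun k hk => (hstep k (by omega)).symm, hstep j hj, sub_self,
      add_zero]
  refine ⟨h1.congr hstep, fun j hj => ?_, ?_⟩
  · rw [h3 j hj.le, Q_congr (α : ℂ) fun k hk => hlt k (by omega), hlt (j + 1) (by omega), sub_self,
      add_zero]
  · rw [h3 m le_rfl, Q_congr (α : ℂ) (f := s) (g := t) fun k hk => (hlt k (by omega)).symm, hlast]
    congr 2
    simp only [schur]
    rw [← hc, Matrix.mul_assoc _ (mpInv (s 0)) (s 0)]

theorem schur_succ_eq (α : ℂ) (s : ℕ → Matrix (Fin q) (Fin q) ℂ) (k : ℕ) :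
    schur α s (k + 1) = schur α (schurStep α s) k := by
  induction k with
  | zero => rfl
  | succ k ih => rw [schur, ih, schur]

/-- The defects of `s` at levels `k ≥ 1` are those of its transform at level `k - 1`. -/
theorem Z_succ (α : ℂ) (s : ℕ → Matrix (Fin q) (Fin q) ℂ) (m : ℕ) :
    Z α s (m + 1) (m + 1) = Z α (schurStep α s) m m + P α s (m + 1) 0 := by
  rw [Z, Finset.sum_range_succ']
  simp only [Nat.add_sub_add_right, P, schur_succ_eq, Z, Nat.sub_zero]

end Main

end

end AlphaStieltjes

theorem theoremT1016 (q : ℕ) (α : ℝ) (m : ℕ) (s : ℕ → Matrix (Fin q) (Fin q) ℂ)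
    (hs : AlphaStieltjes.IsStieltjesNonneg α m s) :
    AlphaStieltjes.Q (α : ℂ) s m
        = AlphaStieltjes.schur (α : ℂ) s m 0 + AlphaStieltjes.Z (α : ℂ) s m m ∧
      ∀ j : ℕ, j < m → AlphaStieltjes.Q (α : ℂ) s j = AlphaStieltjes.schur (α : ℂ) s j 0 := by
  induction m generalizing s with
  | zero => simp [AlphaStieltjes.Q, AlphaStieltjes.L, AlphaStieltjes.schur, AlphaStieltjes.Z]
  | succ m ih =>
    obtain ⟨h1, h2, h3⟩ := hs.schurStep
    obtain ⟨i1, i2⟩ := ih _ h1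
    refine ⟨?_, fun j hj => ?_⟩
    · rw [h3, i1, AlphaStieltjes.Z_succ, AlphaStieltjes.schur_succ_eq, add_assoc]
    · cases j with
      | zero => simp [AlphaStieltjes.Q, AlphaStieltjes.L, AlphaStieltjes.schur]
      | succ j => rw [← h2 j (by omega), i2 j (by omega), AlphaStieltjes.schur_succ_eq]
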